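/- Let $N\in\mathbb N$, let $p$ be a real number with $1<p<N$, and let $\Omega\subseteq\mathbb R^N$ be open. Let $\mathcal D^{1,p}_0(\Omega)$ be the completion of $C_c^\infty(\Omega)$ with respect to the norm $\left(\int_\Omega|\nabla u|^p\,dx\right)^{1/p}$, regarded (by the Sobolev inequality) as a space of functions in $L^{Np/(N-p)}(\mathbb R^N)$. For $F\subset\subset\Omega$ (that is, $\overline F$ is compact and contained in $\Omega$) let $$\mathrm{Cap}_p(F,\Omega)=\inf\left\{\int_\Omega|\nabla u|^p\,dx:\ u\in\mathcal D^{1,p}_0(\Omega),\ u\ge 1\text{ a.e. in a neighbourhood of }F\right\}.$$ Let $\mathcal H(\Omega)$ be the space of all $g\in L^1_{loc}(\Omega)$ for which there is $C>0$ with $\int_\Omega|g||u|^p\,dx\le C\int_\Omega|\nabla u|^p\,dx$ for all $u\in\mathcal D^{1,p}_0(\Omega)$, normed by $$\|g\|=\sup\left\{\frac{\int_F|g|\,dx}{\mathrm{Cap}_p(F,\Omega)}:\ F\subset\subset\Omega\text{ measurable},\ |F|\neq0\right\}.$$ For $g\in L^1_{loc}(\Omega)$ and $r>0$ let $\tilde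 g(r)=\operatorname{ess\,sup}\{|g(y)|: y\in\Omega,\ |y|=r\}$, the essential supremum being taken with respect to $(N-1)$-dimensional surface measure (and $\tilde g(r)=0$ if the sphere $|y|=r$ does not meet $\Omega$), and let $$I(\Omega)=\left\{g\in L^1_{loc}(\Omega):\ \tilde g\in L^1((0,\infty),r^{p-1}dr)\right\},\qquad \|g\|_I=\int_0^\infty r^{p-1}\tilde g(r)\,dr.$$ Then $I(\Omega)$ is continuously embedded into $\mathcal H(\Omega)$: the linear space $I(\Omega)$ is contained in the linear space $\mathcal H(\Omega)$, and $$\|g\|\le C_{N,p}\,\|g\|_I\quad\text{for all }g\in I(\Omega),\qquad C_{N,p}=\left(\frac{p-1}{N-p}\right)^{p-1}.$$ -/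

import Mathlib

open MeasureTheory Set Filter Topology
open scoped ENNReal NNReal ContDiff Gradient

noncomputable section

namespace HardyPotential

/-- `N`-dimensional Euclidean space. -/
abbrev E (N : ℕ) : Type := EuclideanSpace ℝ (Fin N)

variable {N : ℕ}

/-- `φ ∈ C_c^∞(Ω)`, extended by zero to the whole space. -/
structure IsTestFunction (Ω : Set (E N)) (φ : E N → ℝ) : Prop where
  smooth : ContDiff ℝ ∞ φ
  hasCompactSupport : HasCompactSupport φ
  tsupport_subset : tsupport φ ⊆ Ω

/-- The Sobolev exponent `p* = N p / (N - p)` (for `1 ≤ p < N`). -/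
def sobolevExponent (N : ℕ) (p : ℝ) : ℝ≥0∞ := ENNReal.ofReal (N * p / (N - p))

/-- `u` represents an element of the Beppo-Levi space `D_0^{1,p}(Ω)`, `1 < p < N`, and `V` is its
gradient. By the Sobolev inequality, a sequence in `C_c^∞(Ω)` that is Cauchy for the norm
`(∫ |∇φ|^p)^{1/p}` converges in `L^{p*}`, and the completion of `C_c^∞(Ω)` in this norm is the
space of the limits `u`, normed by the `L^p` norm of the limit `V` of the gradients. -/
structure IsBeppoLevi (p : ℝ) (Ω : Set (E N)) (u : E N → ℝ) (V : E N → E N) : Prop where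
  memLp : MemLp u (sobolevExponent N p) volume
  memLp_grad : MemLp V (ENNReal.ofReal p) volume
  approx : ∃ φ : ℕ → E N → ℝ, (∀ n, IsTestFunction Ω (φ n)) ∧
    Tendsto (fun n => eLpNorm (fun x => φ n x - u x) (sobolevExponent N p) volume) atTop (𝓝 0) ∧
    Tendsto (fun n => eLpNorm (fun x => ∇ (φ n) x - V x) (ENNReal.ofReal p) volume) atTop (𝓝 0)

/-- The energy `∫_Ω |V|^p`, with `V` the gradient of an element of the Beppo-Levi space. -/
def energy (p : ℝ) (Ω : Set (E N)) (V : E N → E N) : ℝ≥0∞ := ∫⁻ x in Ω, ‖V x‖ₑ ^ p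

/-- `F` is compactly contained in `Ω`, written `F ⊂⊂ Ω`. -/
def CompactlyContained (F Ω : Set (E N)) : Prop := IsCompact (closure F) ∧ closure F ⊆ Ω

/-- The `p`-capacity of `F` relative to `Ω`: the infimum of `∫_Ω |∇u|^p` over the `u` in
`D_0^{1,p}(Ω)` with `u ≥ 1` (almost everywhere) in a neighbourhood of `F`. -/
def capacity (p : ℝ) (F Ω : Set (E N)) : ℝ≥0∞ :=
  sInf {c | ∃ (u : E N → ℝ) (V : E N → E N), IsBeppoLevi p Ω u V ∧
    (∃ U : Set (E N), IsOpen U ∧ F ⊆ U ∧ ∀ᵐ x ∂volume.restrict U, 1 ≤ u x) ∧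
    c = energy p Ω V}

/-- The norm of the space of Hardy potentials:
`‖g‖ = sup { (∫_F |g|) / Cap_p(F, Ω) : F ⊂⊂ Ω measurable, |F| ≠ 0 }`. -/
def hardyNorm (p : ℝ) (Ω : Set (E N)) (g : E N → ℝ) : ℝ≥0∞ :=
  sSup {c | ∃ F : Set (E N), NullMeasurableSet F volume ∧ CompactlyContained F Ω ∧
    volume F ≠ 0 ∧ c = (∫⁻ x in F, ‖g x‖ₑ) / capacity p F Ω}

/-- `|g|` satisfies the Hardy-Sobolev inequality
`∫_Ω |g| |u|^p ≤ C ∫_Ω |∇u|^p` for all `u ∈ D_0^{1,p}(Ω)`, for some `C > 0`. -/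
def SatisfiesHardySobolev (p : ℝ) (Ω : Set (E N)) (g : E N → ℝ) : Prop :=
  ∃ C : ℝ≥0, 0 < C ∧ ∀ (u : E N → ℝ) (V : E N → E N), IsBeppoLevi p Ω u V →
    ∫⁻ x in Ω, ‖g x‖ₑ * ‖u x‖ₑ ^ p ≤ C * energy p Ω V

/-- The space `H(Ω)` of Hardy potentials. A function on `Ω` is given as a function on the whole
space, whose values outside `Ω` play no role. -/
def hardySpace (p : ℝ) (Ω : Set (E N)) : Submodule ℝ (E N → ℝ) where
  carrier := {g | LocallyIntegrableOn g Ω volume ∧ SatisfiesHardySobolev p Ω g}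
  zero_mem' := ⟨locallyIntegrableOn_zero, 1, one_pos, fun u V _ => by
    by_cases hp : p = 0 <;> simp [hp]⟩
  add_mem' := by
    rintro g h ⟨hg, C, hC, hgC⟩ ⟨hh, D, hD, hhD⟩
    refine ⟨hg.add hh, C + D, by positivity, fun u V huV => ?_⟩
    have hu : AEMeasurable (fun x => ‖u x‖ₑ ^ p) (volume.restrict Ω) :=
      (huV.memLp.aestronglyMeasurable.enorm.pow_const p).restrict
    calc ∫⁻ x in Ω, ‖(g + h) x‖ₑ * ‖u x‖ₑ ^ p
        ≤ ∫⁻ x in Ω, (‖g x‖ₑ * ‖u x‖ₑ ^ p + ‖h x‖ₑ * ‖u x‖ₑ ^ p) := by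
          refine lintegral_mono fun x => ?_
          rw [← add_mul]
          exact mul_le_mul_left (enorm_add_le _ _) _
      _ = (∫⁻ x in Ω, ‖g x‖ₑ * ‖u x‖ₑ ^ p) + ∫⁻ x in Ω, ‖h x‖ₑ * ‖u x‖ₑ ^ p :=
          lintegral_add_left' (hg.aestronglyMeasurable.enorm.mul hu) _
      _ ≤ C * energy p Ω V + D * energy p Ω V := add_le_add (hgC u V huV) (hhD u V huV)
      _ = ((C + D : ℝ≥0) : ℝ≥0∞) * energy p Ω V := by push_cast; ring
  smul_mem' := by
    rintro c g ⟨hg, C, hC, hgC⟩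
    refine ⟨hg.smul c, ‖c‖₊ * C + 1, by positivity, fun u V huV => ?_⟩
    calc ∫⁻ x in Ω, ‖(c • g) x‖ₑ * ‖u x‖ₑ ^ p
        = ∫⁻ x in Ω, ‖c‖ₑ * (‖g x‖ₑ * ‖u x‖ₑ ^ p) := by simp [enorm_mul, mul_assoc]
      _ = ‖c‖ₑ * ∫⁻ x in Ω, ‖g x‖ₑ * ‖u x‖ₑ ^ p := lintegral_const_mul' _ _ enorm_ne_top
      _ ≤ ‖c‖ₑ * (C * energy p Ω V) := by gcongr; exact hgC u V huV
      _ = ((‖c‖₊ * C : ℝ≥0) : ℝ≥0∞) * energy p Ω V := by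
          push_cast; rw [mul_assoc]; rfl
      _ ≤ ((‖c‖₊ * C + 1 : ℝ≥0) : ℝ≥0∞) * energy p Ω V := by gcongr; simp

/-- The radial essential supremum `g̃(r) = ess sup {|g(y)| : y ∈ Ω, |y| = r}`, `r > 0`, with respect
to surface measure. The surface measure of the sphere of radius `r` is `r ^ (N - 1)` times the image
of the surface measure of the unit sphere under `θ ↦ r θ`, so both have the same null sets. -/
def radialEssSup (Ω : Set (E N)) (g : E N → ℝ) (r : ℝ) : ℝ≥0∞ :=
  essSup (fun θ : Metric.sphere (0 : E N) 1 => ‖Ω.indicator g (r • (θ : E N))‖ₑ)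
    (volume : Measure (E N)).toSphere

/-- `‖g‖_I = ∫_0^∞ r^{p-1} g̃(r) dr`. -/
def radialNorm (p : ℝ) (Ω : Set (E N)) (g : E N → ℝ) : ℝ≥0∞ :=
  ∫⁻ r in Ioi (0 : ℝ), ENNReal.ofReal (r ^ (p - 1)) * radialEssSup Ω g r

/-- `g̃` is measurable on `(0, ∞)` as soon as `g` is measurable on `Ω`. -/
theorem aemeasurable_radialEssSup {Ω : Set (E N)} (hΩ : MeasurableSet Ω) {g : E N → ℝ}
    (hg : AEStronglyMeasurable g (volume.restrict Ω)) :
    AEMeasurable (radialEssSup Ω g) (volume.restrict (Ioi (0 : ℝ))) := by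
  have hf : AEStronglyMeasurable (Ω.indicator g) volume :=
    (aestronglyMeasurable_indicator_iff hΩ).2 hg
  set f := Ω.indicator g with hfdef
  set σ := (volume : Measure (E N)).toSphere with hσ
  have hmk : Measurable (hf.mk f) := hf.stronglyMeasurable_mk.measurable
  refine ⟨fun r => essSup (fun θ : Metric.sphere (0 : E N) 1 => ‖hf.mk f (r • (θ : E N))‖ₑ) σ,
    ?_, ?_⟩
  · refine measurable_of_Ioi fun c => ?_
    have hm : MeasurableSet {q : ℝ × Metric.sphere (0 : E N) 1 |
        c < ‖hf.mk f (q.1 • (q.2 : E N))‖ₑ} := by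
      refine measurableSet_lt measurable_const ?_
      exact (hmk.comp (measurable_fst.smul
        (measurable_subtype_coe.comp measurable_snd))).enorm
    have hs := (measurable_measure_prodMk_left (ν := σ) hm)
    have hs' := hs (measurableSet_singleton 0).compl
    refine (congrArg MeasurableSet (Set.ext fun r => ?_)).mpr hs'
    simp only [mem_preimage, mem_Ioi, mem_compl_iff, mem_singleton_iff]
    rw [← not_le, not_iff_not]
    constructor
    · intro h
      have h1 := ENNReal.ae_le_essSup (μ := σ)
        (fun θ : Metric.sphere (0 : E N) 1 => ‖hf.mk f (r • (θ : E N))‖ₑ)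
      have h2 : ∀ᵐ θ : Metric.sphere (0 : E N) 1 ∂σ, ¬ c < ‖hf.mk f (r • (θ : E N))‖ₑ := by
        filter_upwards [h1] with θ hθ using not_lt.2 (hθ.trans h)
      simpa [ae_iff] using h2
    · intro h
      refine essSup_le_of_ae_le c ?_
      have h2 : ∀ᵐ θ : Metric.sphere (0 : E N) 1 ∂σ, ¬ c < ‖hf.mk f (r • (θ : E N))‖ₑ := by
        rw [ae_iff]; simpa using h
      filter_upwards [h2] with θ hθ using not_lt.1 hθ
  · have hmp := (volume : Measure (E N)).measurePreserving_homeomorphUnitSphereProd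
    have h0 : ∀ᵐ x : ({0}ᶜ : Set (E N)) ∂((volume : Measure (E N)).comap Subtype.val), f (x : E N) = hf.mk f (x : E N) := by
      have h := ae_restrict_of_ae (s := ({0}ᶜ : Set (E N))) hf.ae_eq_mk
      rwa [ae_restrict_iff_subtype (measurableSet_singleton _).compl] at h
    have h1 : ∀ᵐ z ∂(σ.prod (Measure.volumeIoiPow (Module.finrank ℝ (E N) - 1))),
        f ((z.2 : ℝ) • (z.1 : E N)) = hf.mk f ((z.2 : ℝ) • (z.1 : E N)) := by
      have h := (hmp.symm (homeomorphUnitSphereProd (E N)).toMeasurableEquiv).quasiMeasurePreserving.ae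
        h0
      simpa using h
    have h2 := Measure.ae_ae_of_ae_prod
      ((Measure.measurePreserving_swap (μ := Measure.volumeIoiPow _) (ν := σ)
        ).quasiMeasurePreserving.ae h1)
    have hν : ∀ᵐ r : Ioi (0 : ℝ) ∂(Measure.volumeIoiPow (Module.finrank ℝ (E N) - 1)),
        radialEssSup Ω g (r : ℝ) = essSup (fun θ : Metric.sphere (0 : E N) 1 =>
          ‖hf.mk f ((r : ℝ) • (θ : E N))‖ₑ) σ := by
      filter_upwards [h2] with r hr
      refine essSup_congr_ae ?_
      filter_upwards [hr] with θ hθ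
      simp only [Prod.swap] at hθ
      rw [← hθ]
    rw [Measure.volumeIoiPow, ae_withDensity_iff (by fun_prop)] at hν
    refine (ae_restrict_iff_subtype measurableSet_Ioi).2 ?_
    filter_upwards [hν] with r hr
    exact hr (by simpa using pow_pos r.2 _)

/-- The space `I(Ω)`: locally integrable functions on `Ω` with
`g̃ ∈ L^1((0, ∞), r^{p-1} dr)`. -/
def radialSpace (p : ℝ) {Ω : Set (E N)} (hΩ : IsOpen Ω) : Submodule ℝ (E N → ℝ) where
  carrier := {g | LocallyIntegrableOn g Ω volume ∧ radialNorm p Ω g < (⊤ : ℝ≥0∞)}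
  zero_mem' := ⟨locallyIntegrableOn_zero, by
    have h : radialEssSup Ω (0 : E N → ℝ) = 0 := by
      funext r
      refine (ENNReal.essSup_eq_zero_iff).2 (ae_of_all _ fun θ => ?_)
      simp
    simp [radialNorm, h]⟩
  add_mem' := by
    rintro g h ⟨hg, hgn⟩ ⟨hh, hhn⟩
    refine ⟨hg.add hh, lt_of_le_of_lt ?_ (ENNReal.add_lt_top.2 ⟨hgn, hhn⟩)⟩
    have hm : AEMeasurable (fun r : ℝ => ENNReal.ofReal (r ^ (p - 1)) * radialEssSup Ω g r)
        (volume.restrict (Ioi (0 : ℝ))) :=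
      AEMeasurable.mul (by fun_prop)
        (aemeasurable_radialEssSup hΩ.measurableSet hg.aestronglyMeasurable)
    rw [radialNorm, radialNorm, radialNorm, ← lintegral_add_left' hm]
    refine lintegral_mono fun r => ?_
    rw [← mul_add]
    refine mul_le_mul_right (le_trans (essSup_mono_ae (ae_of_all _ fun θ => ?_))
      (ENNReal.essSup_add_le _ _)) _
    rw [indicator_add']
    exact enorm_add_le _ _
  smul_mem' := by
    rintro c g ⟨hg, hgn⟩
    refine ⟨hg.smul c, ?_⟩
    have h : radialNorm p Ω (c • g) = ‖c‖ₑ * radialNorm p Ω g := by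
      rw [radialNorm, radialNorm, ← lintegral_const_mul' _ _ enorm_ne_top]
      refine lintegral_congr fun r => ?_
      have : radialEssSup Ω (c • g) r = ‖c‖ₑ * radialEssSup Ω g r := by
        rw [radialEssSup, radialEssSup, ← ENNReal.essSup_const_mul]
        congr 1
        funext θ
        rw [← enorm_mul]
        congr 1
        by_cases hθ : r • (θ : E N) ∈ Ω <;> simp [hθ]
      rw [this]; ring
    rw [h]
    exact ENNReal.mul_lt_top enorm_lt_top hgn

end HardyPotential

end

/-!
The proof is a Hardy inequality with the explicit constant `((p - 1) / (N - p)) ^ (p - 1)`,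
from which both claims follow.

Let `φ` be a test function. On the ray in direction `θ`, Hölder's inequality with the weight
`t ^ (N - 1)`, applied to `φ(rθ) = -∫_r^∞ ∂_t φ(tθ) dt`, gives
`|φ(rθ)|^p ≤ ((p - 1) / (N - p)) ^ (p - 1) * r ^ (p - N) * ∫_0^∞ |∇φ(tθ)|^p t ^ (N - 1) dt`
(`enorm_rpow_le_lintegral_ray`). The last factor does not depend on `r`, and its integral over the
unit sphere is `∫ |∇φ|^p`. Integrating `|g| |φ|^p` in polar coordinates, and bounding `|g|` on the
sphere of radius `r` by `g̃(r)`, leaves the weight `r ^ (N - 1) * r ^ (p - N) = r ^ (p - 1)`, hence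
`∫_Ω |g| |φ|^p ≤ ((p - 1) / (N - p)) ^ (p - 1) * ‖g‖_I * ∫_Ω |∇φ|^p`
(`lintegral_mul_rpow_le_of_isTestFunction`). Fatou's lemma carries this over to the Beppo-Levi
space (`lintegral_mul_rpow_le_energy`), so `g` is a Hardy potential. Inserting a competitor
`u ≥ 1` near `F` gives `∫_F |g| ≤ ((p - 1) / (N - p)) ^ (p - 1) * ‖g‖_I * Cap_p(F, Ω)`
(`lintegral_div_capacity_le`), which is the bound for the norm.
-/

namespace HardyPotential

variable {N : ℕ}

/-! ### A weighted one-dimensional estimate -/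

/-- The `L^{p'}` factor of Hölder's inequality for the weight `t ^ a` on `(r, ∞)`, raised to the
power `p`. -/
theorem lintegral_Ioi_weight_rpow {p a r : ℝ} (hp : 1 < p) (ha : p - 1 < a) (hr : 0 < r) :
    (∫⁻ t in Ioi r, ENNReal.ofReal (t ^ (-(a / (p - 1))))) ^ (p - 1) =
      ENNReal.ofReal (((p - 1) / (a + 1 - p)) ^ (p - 1) * r ^ (p - 1 - a)) := by
  have hp1 : 0 < p - 1 := by linarith
  have hexp : -(a / (p - 1)) < -1 := by
    rw [neg_lt_neg_iff, lt_div_iff₀ hp1]; linarith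
  have hpos : 0 < a + 1 - p := by linarith
  rw [← ofReal_integral_eq_lintegral_ofReal (integrableOn_Ioi_rpow_of_lt hexp hr),
    integral_Ioi_rpow_of_lt hexp hr]
  · have h1 : -r ^ (-(a / (p - 1)) + 1) / (-(a / (p - 1)) + 1) =
        (p - 1) / (a + 1 - p) * r ^ ((p - 1 - a) / (p - 1)) := by
      have e1 : -(a / (p - 1)) + 1 = (p - 1 - a) / (p - 1) := by field_simp; ring
      have hne : p - 1 - a ≠ 0 := by linarith
      rw [e1]
      field_simp
      ring
    rw [h1, ENNReal.ofReal_rpow_of_nonneg (by positivity) hp1.le,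
      Real.mul_rpow (by positivity) (by positivity), ← Real.rpow_mul hr.le,
      div_mul_cancel₀ _ hp1.ne']
  · filter_upwards [ae_restrict_mem measurableSet_Ioi] with t ht
    exact Real.rpow_nonneg (hr.trans ht).le _

/-- A compactly supported function on the line is controlled pointwise by its weighted Dirichlet
integral: Hölder's inequality applied to `ψ r = -∫_r^∞ ψ'` with the weight `t ^ a`. -/
theorem enorm_rpow_le_lintegral_deriv {ψ : ℝ → ℝ} (hψ : ContDiff ℝ 1 ψ) (hc : HasCompactSupport ψ)
    {p a r : ℝ} (hp : 1 < p) (ha : p - 1 < a) (hr : 0 < r) :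
    ‖ψ r‖ₑ ^ p ≤ ENNReal.ofReal (((p - 1) / (a + 1 - p)) ^ (p - 1) * r ^ (p - 1 - a)) *
      ∫⁻ t in Ioi r, ENNReal.ofReal (t ^ a) * ‖deriv ψ t‖ₑ ^ p := by
  have hp0 : 0 < p := by linarith
  have hp1 : 0 < p - 1 := by linarith
  have hmeas : Measurable fun t => ‖deriv ψ t‖ₑ := (hψ.continuous_deriv le_rfl).measurable.enorm
  have hpq : p.conjExponent.HolderConjugate p := (Real.HolderConjugate.conjExponent hp).symm
  have h1 : ‖ψ r‖ₑ ≤ ∫⁻ t in Ioi r, ‖deriv ψ t‖ₑ := by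
    rw [← enorm_neg, ← hc.integral_Ioi_deriv_eq hψ r]
    exact enorm_integral_le_lintegral_enorm _
  -- Insert `1 = t ^ (-(a / p)) * t ^ (a / p)`, so that the second factor to the power `p` carries
  -- the weight `t ^ a`.
  have h2 : ∫⁻ t in Ioi r, ‖deriv ψ t‖ₑ =
      ∫⁻ t in Ioi r, ((fun t : ℝ => ENNReal.ofReal (t ^ (-(a / p)))) *
        fun t : ℝ => ENNReal.ofReal (t ^ (a / p)) * ‖deriv ψ t‖ₑ) t := by
    refine setLIntegral_congr_fun measurableSet_Ioi fun t ht => ?_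
    have ht0 : 0 < t := hr.trans ht
    simp only [Pi.mul_apply]
    rw [← mul_assoc, ← ENNReal.ofReal_mul (by positivity), ← Real.rpow_add ht0]
    simp
  have h3 := ENNReal.lintegral_mul_le_Lp_mul_Lq (volume.restrict (Ioi r)) hpq
    (f := fun t : ℝ => ENNReal.ofReal (t ^ (-(a / p))))
    (g := fun t : ℝ => ENNReal.ofReal (t ^ (a / p)) * ‖deriv ψ t‖ₑ)
    (by fun_prop) (by fun_prop)
  have h4 : ∫⁻ t in Ioi r, ENNReal.ofReal (t ^ (-(a / p))) ^ p.conjExponent =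
      ∫⁻ t in Ioi r, ENNReal.ofReal (t ^ (-(a / (p - 1)))) := by
    refine setLIntegral_congr_fun measurableSet_Ioi fun t ht => ?_
    have ht0 : 0 < t := hr.trans ht
    rw [ENNReal.ofReal_rpow_of_pos (by positivity), ← Real.rpow_mul ht0.le, Real.conjExponent]
    congr 2
    field_simp
  have h5 : ∫⁻ t in Ioi r, (ENNReal.ofReal (t ^ (a / p)) * ‖deriv ψ t‖ₑ) ^ p =
      ∫⁻ t in Ioi r, ENNReal.ofReal (t ^ a) * ‖deriv ψ t‖ₑ ^ p := by
    refine setLIntegral_congr_fun measurableSet_Ioi fun t ht => ?_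
    have ht0 : 0 < t := hr.trans ht
    rw [ENNReal.mul_rpow_of_nonneg _ _ hp0.le, ENNReal.ofReal_rpow_of_pos (by positivity),
      ← Real.rpow_mul ht0.le, div_mul_cancel₀ _ hp0.ne']
  rw [h4, h5] at h3
  calc ‖ψ r‖ₑ ^ p ≤ _ := ENNReal.rpow_le_rpow ((h1.trans_eq h2).trans h3) hp0.le
    _ = _ := by
      rw [ENNReal.mul_rpow_of_nonneg _ _ hp0.le, ← ENNReal.rpow_mul, ← ENNReal.rpow_mul,
        one_div_mul_cancel hp0.ne', ENNReal.rpow_one, ← lintegral_Ioi_weight_rpow hp ha hr]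
      congr 2
      rw [Real.conjExponent]
      field_simp

/-! ### Polar coordinates -/

theorem lintegral_eq_lintegral_sphere_prod (f : E N → ℝ≥0∞) [Nontrivial (E N)] :
    ∫⁻ x, f x = ∫⁻ z : Metric.sphere (0 : E N) 1 × Ioi (0 : ℝ), f ((z.2 : ℝ) • (z.1 : E N))
      ∂((volume : Measure (E N)).toSphere.prod (Measure.volumeIoiPow (N - 1))) := by
  have hmp := (volume : Measure (E N)).measurePreserving_homeomorphUnitSphereProd
  rw [finrank_euclideanSpace_fin] at hmp
  have h := (hmp.symm (homeomorphUnitSphereProd (E N)).toMeasurableEquiv).lintegral_comp_emb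
    (MeasurableEquiv.measurableEmbedding _) (fun x => f x)
  rw [lintegral_subtype_comap (measurableSet_singleton _).compl, restrict_compl_singleton] at h
  rw [← h]
  rfl

theorem lintegral_volumeIoiPow (n : ℕ) (f : ℝ → ℝ≥0∞) :
    ∫⁻ r : Ioi (0 : ℝ), f r ∂(Measure.volumeIoiPow n) =
      ∫⁻ r in Ioi (0 : ℝ), ENNReal.ofReal (r ^ n) * f r := by
  rw [Measure.volumeIoiPow, lintegral_withDensity_eq_lintegral_mul_non_measurable _ (by fun_prop)
    (ae_of_all _ fun _ => ENNReal.ofReal_lt_top)]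
  exact lintegral_subtype_comap measurableSet_Ioi fun r : ℝ => ENNReal.ofReal (r ^ n) * f r

/-- Integration in polar coordinates, spheres first. No measurability is needed for this
inequality. -/
theorem lintegral_le_lintegral_Ioi_sphere (f : E N → ℝ≥0∞) [Nontrivial (E N)] :
    ∫⁻ x, f x ≤ ∫⁻ r in Ioi (0 : ℝ), ENNReal.ofReal (r ^ (N - 1)) *
      ∫⁻ θ : Metric.sphere (0 : E N) 1, f (r • (θ : E N)) ∂(volume : Measure (E N)).toSphere := by
  rw [lintegral_eq_lintegral_sphere_prod, ← lintegral_prod_swap, ← lintegral_volumeIoiPow]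
  exact lintegral_prod_le _

/-- Integration in polar coordinates, rays first. -/
theorem lintegral_eq_lintegral_sphere_Ioi {f : E N → ℝ≥0∞} (hf : Measurable f)
    [Nontrivial (E N)] :
    ∫⁻ x, f x = ∫⁻ θ : Metric.sphere (0 : E N) 1, (∫⁻ r in Ioi (0 : ℝ),
      ENNReal.ofReal (r ^ (N - 1)) * f (r • (θ : E N))) ∂(volume : Measure (E N)).toSphere := by
  rw [lintegral_eq_lintegral_sphere_prod, lintegral_prod]
  · exact lintegral_congr fun θ => lintegral_volumeIoiPow (N - 1) fun r => f (r • (θ : E N))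
  · exact (hf.comp (by fun_prop)).aemeasurable

/-! ### The Hardy inequality for test functions -/

/-- The one-dimensional estimate along the ray in direction `θ`. -/
theorem enorm_rpow_le_lintegral_ray {p : ℝ} (hp : 1 < p) (hpN : p < N) {φ : E N → ℝ}
    (hφ : ContDiff ℝ ∞ φ) (hc : HasCompactSupport φ) {r : ℝ} (hr : 0 < r)
    (θ : Metric.sphere (0 : E N) 1) :
    ‖φ (r • (θ : E N))‖ₑ ^ p ≤ ENNReal.ofReal (((p - 1) / (N - p)) ^ (p - 1) * r ^ (p - N)) *
      ∫⁻ t in Ioi (0 : ℝ), ENNReal.ofReal (t ^ (N - 1)) * ‖∇ φ (t • (θ : E N))‖ₑ ^ p := by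
  have hN : 1 ≤ N := by
    have : (1 : ℝ) < N := hp.trans hpN
    exact_mod_cast this.le
  have hθ : ‖(θ : E N)‖ = 1 := by simp
  have hray : IsClosedEmbedding fun t : ℝ => t • (θ : E N) :=
    isClosedEmbedding_smul_left (by rw [← norm_ne_zero_iff, hθ]; exact one_ne_zero)
  have hψ : ContDiff ℝ 1 fun t : ℝ => φ (t • (θ : E N)) :=
    (hφ.of_le (by exact_mod_cast le_top)).comp (contDiff_id.smul contDiff_const)
  have h := enorm_rpow_le_lintegral_deriv (a := (N : ℝ) - 1) hψ (hc.comp_isClosedEmbedding hray)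
    hp (by linarith) hr
  have hderiv (t : ℝ) : ‖deriv (fun t : ℝ => φ (t • (θ : E N))) t‖ₑ ≤ ‖∇ φ (t • (θ : E N))‖ₑ := by
    have hd : DifferentiableAt ℝ φ (t • (θ : E N)) := hφ.differentiable (by simp) _
    have h1 : HasDerivAt (fun t : ℝ => φ (t • (θ : E N)))
        (fderiv ℝ φ (t • (θ : E N)) ((1 : ℝ) • (θ : E N))) t :=
      hd.hasFDerivAt.comp_hasDerivAt t ((hasDerivAt_id t).smul_const (θ : E N))
    rw [h1.deriv, one_smul, gradient, enorm_le_iff_norm_le, LinearIsometryEquiv.norm_map]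
    simpa [hθ] using (fderiv ℝ φ (t • (θ : E N))).le_opNorm (θ : E N)
  rw [show (N : ℝ) - 1 + 1 - p = N - p by ring, show p - 1 - ((N : ℝ) - 1) = p - N by ring] at h
  refine h.trans (mul_le_mul_right ?_ _)
  refine (lintegral_mono_set (Ioi_subset_Ioi hr.le)).trans (setLIntegral_mono'
    measurableSet_Ioi fun t ht => ?_)
  have hp0 : 0 ≤ p := by linarith
  rw [← Real.rpow_natCast, Nat.cast_pred hN]
  gcongr
  exact hderiv t

theorem measurable_enorm_gradient_rpow {p : ℝ} {φ : E N → ℝ} (hφ : ContDiff ℝ ∞ φ) :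
    Measurable fun x => ‖∇ φ x‖ₑ ^ p := by
  have : Continuous (∇ φ) :=
    (InnerProductSpace.toDual ℝ (E N)).symm.continuous.comp (hφ.continuous_fderiv (by simp))
  exact this.measurable.enorm.pow_const p

/-- The Hardy inequality for test functions: bound `|g|` on each sphere by its essential supremum,
and `|φ|^p` by the integral of `|∇φ|^p` along rays. -/
theorem lintegral_mul_rpow_le_of_isTestFunction {p : ℝ} (hp : 1 < p) (hpN : p < N)
    {Ω : Set (E N)} (hΩ : MeasurableSet Ω) {g : E N → ℝ}
    (hg : AEStronglyMeasurable g (volume.restrict Ω)) {φ : E N → ℝ} (hφ : IsTestFunction Ω φ) :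
    ∫⁻ x in Ω, ‖g x‖ₑ * ‖φ x‖ₑ ^ p ≤
      ENNReal.ofReal (((p - 1) / (N - p)) ^ (p - 1)) * radialNorm p Ω g * energy p Ω (∇ φ) := by
  have hN : 1 < N := by
    have : (1 : ℝ) < N := hp.trans hpN
    exact_mod_cast this
  have : NeZero N := ⟨by lia⟩
  have hp0 : 0 < p := by linarith
  have hNp : 0 < N - p := by linarith
  set K := ENNReal.ofReal (((p - 1) / (N - p)) ^ (p - 1))
  set σ := (volume : Measure (E N)).toSphere
  set A : Metric.sphere (0 : E N) 1 → ℝ≥0∞ := fun θ => ∫⁻ t in Ioi (0 : ℝ),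
    ENNReal.ofReal (t ^ (N - 1)) * ‖∇ φ (t • (θ : E N))‖ₑ ^ p with hA
  have hAm : Measurable A := by
    refine Measurable.lintegral_prod_right' (f := fun z : Metric.sphere (0 : E N) 1 × ℝ =>
      ENNReal.ofReal (z.2 ^ (N - 1)) * ‖∇ φ (z.2 • (z.1 : E N))‖ₑ ^ p) ?_
    exact (by fun_prop : Measurable fun z : Metric.sphere (0 : E N) 1 × ℝ =>
      ENNReal.ofReal (z.2 ^ (N - 1))).mul
        ((measurable_enorm_gradient_rpow (p := p) hφ.smooth).comp
          (by fun_prop : Continuous fun z : Metric.sphere (0 : E N) 1 × ℝ =>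
            z.2 • (z.1 : E N)).measurable)
  -- `∇ φ` vanishes off `Ω`, so the integral over the whole space is the energy on `Ω`.
  have hgrad : ∫⁻ θ, A θ ∂σ = energy p Ω (∇ φ) := by
    rw [hA, ← lintegral_eq_lintegral_sphere_Ioi
      (measurable_enorm_gradient_rpow (p := p) hφ.smooth), energy, ← lintegral_indicator hΩ]
    refine lintegral_congr fun x => ?_
    by_cases hx : x ∈ Ω
    · rw [indicator_of_mem hx]
    · have h0 : fderiv ℝ φ x = 0 := image_eq_zero_of_notMem_tsupport fun h =>
        hx (hφ.tsupport_subset (tsupport_fderiv_subset ℝ h))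
      simp [hx, gradient, h0, hp0]
  have hsphere (r : ℝ) (hr : r ∈ Ioi (0 : ℝ)) :
      ENNReal.ofReal (r ^ (N - 1)) * ∫⁻ θ : Metric.sphere (0 : E N) 1,
        Ω.indicator (fun x => ‖g x‖ₑ * ‖φ x‖ₑ ^ p) (r • (θ : E N)) ∂σ ≤
      ENNReal.ofReal (r ^ (p - 1)) * radialEssSup Ω g r * (K * energy p Ω (∇ φ)) := by
    have hr0 : (0 : ℝ) < r := hr
    calc _ ≤ ENNReal.ofReal (r ^ (N - 1)) * ∫⁻ θ : Metric.sphere (0 : E N) 1,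
          (radialEssSup Ω g r * (K * ENNReal.ofReal (r ^ (p - N)))) * A θ ∂σ := by
          refine mul_le_mul_right (lintegral_mono_ae ?_) _
          filter_upwards [ENNReal.ae_le_essSup (μ := σ)
            (fun θ : Metric.sphere (0 : E N) 1 => ‖Ω.indicator g (r • (θ : E N))‖ₑ)] with θ hθ
          have h := enorm_rpow_le_lintegral_ray hp hpN hφ.smooth hφ.hasCompactSupport hr0 θ
          rw [ENNReal.ofReal_mul (by positivity)] at h
          rw [mul_assoc]
          refine le_trans ?_ (mul_le_mul' hθ h)
          by_cases hx : r • (θ : E N) ∈ Ω <;> simp [hx]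
      _ = ENNReal.ofReal (r ^ (N - 1)) * ((radialEssSup Ω g r *
          (K * ENNReal.ofReal (r ^ (p - N)))) * energy p Ω (∇ φ)) := by
          rw [lintegral_const_mul _ hAm, hgrad]
      _ = (ENNReal.ofReal (r ^ (N - 1)) * ENNReal.ofReal (r ^ (p - N))) *
          radialEssSup Ω g r * (K * energy p Ω (∇ φ)) := by ring
      _ = _ := by
          rw [← ENNReal.ofReal_mul (by positivity), ← Real.rpow_natCast, ← Real.rpow_add hr0,
            Nat.cast_pred (by lia)]
          congr 4
          ring
  rw [← lintegral_indicator hΩ]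
  refine (lintegral_le_lintegral_Ioi_sphere _).trans
    ((setLIntegral_mono' measurableSet_Ioi hsphere).trans_eq ?_)
  have hm : AEMeasurable (fun r : ℝ => ENNReal.ofReal (r ^ (p - 1)) * radialEssSup Ω g r)
      (volume.restrict (Ioi (0 : ℝ))) :=
    AEMeasurable.mul (by fun_prop) (aemeasurable_radialEssSup hΩ hg)
  rw [lintegral_mul_const'' _ hm, radialNorm]
  ring

/-! ### Extension to the Beppo-Levi space -/

/-- The Hardy inequality on the Beppo-Levi space, by density of test functions and Fatou's
lemma. -/
theorem lintegral_mul_rpow_le_energy {p : ℝ} (hp : 1 < p) (hpN : p < N)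
    {Ω : Set (E N)} (hΩ : MeasurableSet Ω) {g : E N → ℝ}
    (hg : AEStronglyMeasurable g (volume.restrict Ω)) (hgn : radialNorm p Ω g ≠ ⊤)
    {u : E N → ℝ} {V : E N → E N} (huV : IsBeppoLevi p Ω u V) :
    ∫⁻ x in Ω, ‖g x‖ₑ * ‖u x‖ₑ ^ p ≤
      ENNReal.ofReal (((p - 1) / (N - p)) ^ (p - 1)) * radialNorm p Ω g * energy p Ω V := by
  have hp0 : 0 < p := by linarith
  have hNp : 0 < (N : ℝ) - p := by linarith
  have hN0 : 0 < (N : ℝ) := by linarith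
  obtain ⟨φ, hφ, hφu, hφV⟩ := huV.approx
  set K := ENNReal.ofReal (((p - 1) / (N - p)) ^ (p - 1)) * radialNorm p Ω g
  have hKtop : K ≠ ⊤ := ENNReal.mul_ne_top ENNReal.ofReal_ne_top hgn
  have hgradm (n : ℕ) : AEStronglyMeasurable (∇ (φ n)) (volume.restrict Ω) :=
    ((InnerProductSpace.toDual ℝ (E N)).symm.continuous.comp
      ((hφ n).smooth.continuous_fderiv (by simp))).aestronglyMeasurable
  have hexp : sobolevExponent N p ≠ 0 := by
    rw [sobolevExponent, ne_eq, ENNReal.ofReal_eq_zero, not_le]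
    positivity
  obtain ⟨ns, hns, hlim⟩ := (tendstoInMeasure_of_tendsto_eLpNorm hexp
    (fun n => (hφ n).smooth.continuous.aestronglyMeasurable) huV.memLp.aestronglyMeasurable
    hφu).exists_seq_tendsto_ae
  have hnorm (W : E N → E N) : eLpNorm W (ENNReal.ofReal p) (volume.restrict Ω) ^ p =
      energy p Ω W := by
    rw [eLpNorm_eq_lintegral_rpow_enorm_toReal (by simpa using hp0) ENNReal.ofReal_ne_top,
      ENNReal.toReal_ofReal hp0.le, ← ENNReal.rpow_mul, one_div_mul_cancel hp0.ne',
      ENNReal.rpow_one, energy]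
  have hbound (n : ℕ) : ∫⁻ x in Ω, ‖g x‖ₑ * ‖φ n x‖ₑ ^ p ≤
      K * (eLpNorm V (ENNReal.ofReal p) (volume.restrict Ω) +
        eLpNorm (fun x => ∇ (φ n) x - V x) (ENNReal.ofReal p) volume) ^ p := by
    refine (lintegral_mul_rpow_le_of_isTestFunction hp hpN hΩ hg (hφ n)).trans
      (mul_le_mul_right ?_ _)
    rw [← hnorm]
    refine ENNReal.rpow_le_rpow ?_ hp0.le
    have hV := huV.memLp_grad.aestronglyMeasurable.restrict (s := Ω)
    calc eLpNorm (∇ (φ n)) (ENNReal.ofReal p) (volume.restrict Ω)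
        = eLpNorm (V + (∇ (φ n) - V)) (ENNReal.ofReal p) (volume.restrict Ω) := by
          rw [add_sub_cancel]
      _ ≤ _ := eLpNorm_add_le hV ((hgradm n).sub hV) (by simpa using hp.le)
      _ ≤ _ := by gcongr; exact eLpNorm_mono_measure _ Measure.restrict_le_self
  have hconv : Tendsto (fun i => K * (eLpNorm V (ENNReal.ofReal p) (volume.restrict Ω) +
        eLpNorm (fun x => ∇ (φ (ns i)) x - V x) (ENNReal.ofReal p) volume) ^ p) atTop
      (𝓝 (K * energy p Ω V)) := by
    refine ENNReal.Tendsto.const_mul ?_ (Or.inr hKtop)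
    have h := (tendsto_const_nhds (x := eLpNorm V (ENNReal.ofReal p) (volume.restrict Ω))).add
      (hφV.comp hns.tendsto_atTop)
    rw [add_zero] at h
    rw [← hnorm]
    exact h.ennrpow_const p
  calc ∫⁻ x in Ω, ‖g x‖ₑ * ‖u x‖ₑ ^ p
      = ∫⁻ x in Ω, liminf (fun i => ‖g x‖ₑ * ‖φ (ns i) x‖ₑ ^ p) atTop := by
        refine lintegral_congr_ae ?_
        filter_upwards [ae_restrict_of_ae hlim] with x hx
        exact (ENNReal.Tendsto.const_mul (hx.enorm.ennrpow_const p)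
          (Or.inr enorm_ne_top)).liminf_eq.symm
    _ ≤ liminf (fun i => ∫⁻ x in Ω, ‖g x‖ₑ * ‖φ (ns i) x‖ₑ ^ p) atTop :=
        lintegral_liminf_le' fun i => hg.enorm.mul
          ((hφ (ns i)).smooth.continuous.measurable.enorm.pow_const p).aemeasurable
    _ ≤ liminf (fun i => K * (eLpNorm V (ENNReal.ofReal p) (volume.restrict Ω) +
        eLpNorm (fun x => ∇ (φ (ns i)) x - V x) (ENNReal.ofReal p) volume) ^ p) atTop :=
        liminf_le_liminf (Eventually.of_forall fun i => hbound (ns i))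
    _ = K * energy p Ω V := hconv.liminf_eq

/-! ### Capacity -/

/-- A Hardy inequality for `|g|` bounds `∫_F |g|` by the capacity of `F`: test it with the
competitors for the capacity. -/
theorem lintegral_div_capacity_le {p : ℝ} (hp : 0 < p) {Ω F : Set (E N)} {g : E N → ℝ} {K : ℝ≥0∞}
    (hH : ∀ (u : E N → ℝ) (V : E N → E N), IsBeppoLevi p Ω u V →
      ∫⁻ x in Ω, ‖g x‖ₑ * ‖u x‖ₑ ^ p ≤ K * energy p Ω V) (hFΩ : F ⊆ Ω) :
    (∫⁻ x in F, ‖g x‖ₑ) / capacity p F Ω ≤ K := by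
  -- Dividing by the infimum is taking the supremum of the quotients; this covers capacity `0`, and
  -- capacity `⊤` when there is no competitor.
  rw [capacity, sInf_eq_iInf', div_eq_mul_inv, ENNReal.inv_iInf, ENNReal.mul_iSup]
  refine iSup_le ?_
  rintro ⟨c, u, V, huV, ⟨U, -, hFU, hu⟩, rfl⟩
  refine ENNReal.div_le_of_le_mul (le_trans ?_ (hH u V huV))
  refine le_trans (lintegral_mono_ae ?_) (lintegral_mono_set hFΩ)
  filter_upwards [ae_restrict_of_ae_restrict_of_subset hFU hu] with x hx
  refine le_mul_of_one_le_right' (ENNReal.one_le_rpow ?_ hp)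
  rw [← enorm_one (G := ℝ), enorm_le_iff_norm_le, norm_one]
  exact hx.trans (le_abs_self _)

end HardyPotential

theorem mainTheorem11 (N : ℕ) (p : ℝ) (hp : 1 < p) (hpN : p < N)
    (Ω : Set (HardyPotential.E N)) (hΩ : IsOpen Ω) :
    HardyPotential.radialSpace p hΩ ≤ HardyPotential.hardySpace p Ω ∧
    ∀ g ∈ HardyPotential.radialSpace p hΩ,
      HardyPotential.hardyNorm p Ω g ≤
        ENNReal.ofReal (((p - 1) / (N - p)) ^ (p - 1)) * HardyPotential.radialNorm p Ω g := by
  have hardy (g : HardyPotential.E N → ℝ) (hg : g ∈ HardyPotential.radialSpace p hΩ)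
      (u : HardyPotential.E N → ℝ) (V : HardyPotential.E N → HardyPotential.E N)
      (huV : HardyPotential.IsBeppoLevi p Ω u V) :=
    HardyPotential.lintegral_mul_rpow_le_energy hp hpN hΩ.measurableSet
      hg.1.aestronglyMeasurable hg.2.ne huV
  have hfin (g : HardyPotential.E N → ℝ) (hg : g ∈ HardyPotential.radialSpace p hΩ) :=
    ENNReal.mul_ne_top (a := ENNReal.ofReal (((p - 1) / (N - p)) ^ (p - 1)))
      ENNReal.ofReal_ne_top hg.2.ne
  refine ⟨fun g hg => ⟨hg.1, ?_⟩, fun g hg => sSup_le ?_⟩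
  -- Adding `1` makes the constant positive when `‖g‖_I = 0`.
  · refine ⟨(ENNReal.ofReal (((p - 1) / (N - p)) ^ (p - 1)) *
      HardyPotential.radialNorm p Ω g).toNNReal + 1, by positivity, fun u V huV => ?_⟩
    refine (hardy g hg u V huV).trans (mul_le_mul_left ?_ _)
    rw [ENNReal.coe_add, ENNReal.coe_toNNReal (hfin g hg)]
    exact le_self_add
  · rintro c ⟨F, -, hFΩ, -, rfl⟩
    exact HardyPotential.lintegral_div_capacity_le (by linarith) (hardy g hg)
      (subset_closure.trans hFΩ.2)
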